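/- A planar convex body is a compact convex set $K\subset\mathbb R^2$ containing at least two points (the interior may be empty). Let $p(K)$ be its perimeter (for a line segment: twice its length), $R(K)$ its circumradius, i.e. the smallest radius of a Euclidean disc containing $K$, and $w(K)$ its minimum width, i.e. the smallest distance between two parallel lines containing $K$ between them. Then every planar convex body $K$ satisfies \[ p(K)\;\ge\;4\left(\sqrt{R(K)^2-\frac{w(K)^2}{9}}+\frac{w(K)}{3}\arcsin\left(\frac{w(K)}{3R(K)}\right)\right), \] and equality holds if $K$ is a (nondegenerate) line segment. -/

import Mathlib

open scoped ENNReal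

/-- The Euclidean plane. -/
abbrev Plane : Type := EuclideanSpace ℝ (Fin 2)

/-- The determinant of two plane vectors. -/
def planeCross (a b : Plane) : ℝ := a 0 * b 1 - a 1 * b 0

/-- The points `x 0, …, x n` are, in this order, the vertices of a strictly convex polygon traversed
once counterclockwise. There is no condition on one or two points: two points form the degenerate
convex polygon that runs along their segment and back. -/
def IsConvexPolygon {n : ℕ} (x : Fin (n + 1) → Plane) : Prop :=
  ∀ i j k : Fin (n + 1), i < j → j < k → 0 < planeCross (x j - x i) (x k - x i)

/-- The length of the closed polygon `x 0, x 1, …, x n, x 0` (addition in `Fin (n + 1)` is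
cyclic). -/
noncomputable def closedPolygonLength {n : ℕ} (x : Fin (n + 1) → Plane) : ℝ≥0∞ :=
  ∑ i : Fin (n + 1), edist (x i) (x (i + 1))

/-- The perimeter of a planar convex body: the supremum of the perimeters of the convex polygons
with vertices in it. This is the arc length of the boundary curve; for a segment, whose
boundary is traversed in both directions, it is twice the length. -/
noncomputable def perimeter (K : Set Plane) : ℝ≥0∞ :=
  ⨆ (n : ℕ) (x : Fin (n + 1) → Plane) (_ : IsConvexPolygon x) (_ : ∀ i, x i ∈ K),
    closedPolygonLength x

/-- The circumradius: the smallest radius of a disc containing `K`. -/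
noncomputable def circumradius (K : Set Plane) : ℝ :=
  sInf {ρ : ℝ | ∃ c : Plane, K ⊆ Metric.closedBall c ρ}

/-- The minimum width: the smallest distance `d` between two parallel lines
`⟪u, x⟫ = a` and `⟪u, x⟫ = a + d` (with `u` a unit normal) that contain `K` between them. -/
noncomputable def minWidth (K : Set Plane) : ℝ :=
  sInf {d : ℝ | ∃ u : Plane, ‖u‖ = 1 ∧ ∃ a : ℝ, ∀ x ∈ K, a ≤ inner ℝ u x ∧ inner ℝ u x ≤ a + d}

/-- The quantity `4 (√(R² - w²/9) + (w/3) arcsin (w/(3R)))`. -/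
noncomputable def perimeterLowerBound (R w : ℝ) : ℝ :=
  4 * (Real.sqrt (R ^ 2 - w ^ 2 / 9) + w / 3 * Real.arcsin (w / (3 * R)))

/-! ### Real inequalities -/

/-! Write R, w for circumradius and minimum width. Two lower bounds for the perimeter are compared
with the claimed one. The centre of the smallest enclosing disc is a convex combination of at most
three contact points of `K` with the circle (`exists_fin_three_center`). They give a possibly
degenerate inscribed triangle xyz around the centre, with xy chosen to subtend a central angle of at
least 120°, so that its distance m from the centre is at most R/2. Then xy = 2√(R² - m²). The vertex
z lies on the arc between the antipodes of x and y, where yz + zx is least at the ends, with value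
2R + 2m. Hence p ≥ 2√(R² - m²) + 2(R + m). On the other hand, a diametral pair of points together
with the points of `K` farthest from its line on either side yields p ≥ 2√(xy² + w²)
(`two_mul_sqrt_le_perimeter`). The triangle bound suffices for large m, the width bound for small m
(`perimeterLowerBound_le_or`). -/

lemma arcsin_le_of_le_two_thirds {t : ℝ} (h0 : 0 ≤ t) (h1 : t ≤ 2 / 3) :
    Real.arcsin t ≤ 11 / 10 * t := by
  have hpi := Real.pi_gt_three
  rw [Real.arcsin_le_iff_le_sin ⟨by linarith, by linarith⟩ ⟨by linarith, by linarith⟩]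
  -- The constant 11/10 lies just above the chord slope arcsin(2/3)/(2/3) ≈ 1.095, and the cubic
  -- bound for the sine still suffices for it.
  have h := Real.sin_ge_sub_cube (x := 11 / 10 * t) (by positivity)
  nlinarith [mul_nonneg h0 (by nlinarith : (0 : ℝ) ≤ 4 / 9 - t ^ 2)]

/-- Replaces the transcendental bound by a rational one; the constant is 4(11/90 - 1/18) = 4/15. -/
lemma perimeterLowerBound_le {R w : ℝ} (hR : 0 < R) (hw : 0 ≤ w) (hwR : w ≤ 2 * R) :
    perimeterLowerBound R w ≤ 4 * R + 4 / 15 * (w ^ 2 / R) := by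
  have ht : w / (3 * R) ≤ 2 / 3 := by
    rw [div_le_iff₀ (by positivity)]; linarith
  have h1 := arcsin_le_of_le_two_thirds (by positivity) ht
  have h2 : Real.sqrt (R ^ 2 - w ^ 2 / 9) ≤ R - w ^ 2 / R / 18 := by
    have h3 : w ^ 2 / R ≤ 4 * R := by
      rw [div_le_iff₀ hR]; nlinarith
    refine Real.sqrt_le_iff.mpr ⟨by linarith, ?_⟩
    have h4 : R * (w ^ 2 / R) = w ^ 2 := by field_simp
    nlinarith [sq_nonneg (w ^ 2 / R)]
  have h5 : w / 3 * Real.arcsin (w / (3 * R)) ≤ w / 3 * (11 / 10 * (w / (3 * R))) :=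
    mul_le_mul_of_nonneg_left h1 (by positivity)
  have h6 : w / 3 * (11 / 10 * (w / (3 * R))) = 11 / 90 * (w ^ 2 / R) := by
    field_simp; ring
  unfold perimeterLowerBound
  linarith

lemma perimeterLowerBound_le_or {R w m : ℝ} (hR : 0 < R) (hw : 0 ≤ w) (hwR : w ≤ 2 * R)
    (hm : 0 ≤ m) (hmR : m ≤ R / 2) :
    perimeterLowerBound R w ≤ 2 * Real.sqrt (R ^ 2 - m ^ 2) + 2 * (R + m) ∨
      perimeterLowerBound R w ≤ 2 * Real.sqrt (4 * (R ^ 2 - m ^ 2) + w ^ 2) := by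
  have hb := perimeterLowerBound_le hR hw hwR
  obtain ⟨k, rfl⟩ : ∃ k, m = R * k := ⟨m / R, by field_simp⟩
  obtain ⟨v, rfl⟩ : ∃ v, w = R * v := ⟨w / R, by field_simp⟩
  have hk : 0 ≤ k := by
    by_contra! h; nlinarith
  have hk2 : k ≤ 1 / 2 := by
    by_contra! h; nlinarith
  have hv : 0 ≤ v := by
    by_contra! h; nlinarith
  have hv2 : v ≤ 2 := by
    by_contra! h; nlinarith
  have e1 : (R * v) ^ 2 / R = R * v ^ 2 := by field_simp
  have e2 : Real.sqrt (R ^ 2 - (R * k) ^ 2) = R * Real.sqrt (1 - k ^ 2) := by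
    rw [show R ^ 2 - (R * k) ^ 2 = R ^ 2 * (1 - k ^ 2) by ring,
      Real.sqrt_mul (by positivity), Real.sqrt_sq hR.le]
  have e3 : Real.sqrt (4 * (R ^ 2 - (R * k) ^ 2) + (R * v) ^ 2) =
      R * Real.sqrt (4 * (1 - k ^ 2) + v ^ 2) := by
    rw [show 4 * (R ^ 2 - (R * k) ^ 2) + (R * v) ^ 2 = R ^ 2 * (4 * (1 - k ^ 2) + v ^ 2) by ring,
      Real.sqrt_mul (by positivity), Real.sqrt_sq hR.le]
  rw [e1] at hb
  rw [e2, e3]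
  -- After scaling to R = 1 the target is 4 + (12/5)s, and m has become k.
  obtain ⟨s, hs⟩ : ∃ s, s = v ^ 2 / 9 := ⟨_, rfl⟩
  have hv9 : v ^ 2 = 9 * s := by linarith
  have hs0 : 0 ≤ s := by rw [hs]; positivity
  have hs1 : s ≤ 4 / 9 := by nlinarith
  rw [hv9] at hb ⊢
  rcases le_total (5 / 3 * s) k with h | h
  · left
    -- By concavity the circle lies above its chord over [0, 1/2], of slope -(2 - √3) ≈ -0.268. The
    -- triangle bound is then at least 4 + 1.46k, and 1.46 · 5/3 > 12/5.
    have : 1 - 27 / 100 * k ≤ Real.sqrt (1 - k ^ 2) := by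
      apply Real.le_sqrt_of_sq_le
      nlinarith
    nlinarith [mul_le_mul_of_nonneg_left this hR.le]
  · right
    have : 2 + 6 / 5 * s ≤ Real.sqrt (4 * (1 - k ^ 2) + 9 * s) := by
      apply Real.le_sqrt_of_sq_le
      -- For small s the bound k ≤ 5s/3 is the useful one, for large s the bound k ≤ 1/2.
      rcases le_total s (1 / 3) with h3 | h3
      · nlinarith
      · nlinarith
    nlinarith [mul_le_mul_of_nonneg_left this hR.le]

/-- The triangle inequality for the vectors (a, 2h) and (a, 2k). -/
lemma two_mul_sqrt_le_sqrt_add_sqrt (a h k : ℝ) :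
    2 * Real.sqrt (a ^ 2 + (h + k) ^ 2) ≤
      Real.sqrt (a ^ 2 + 4 * h ^ 2) + Real.sqrt (a ^ 2 + 4 * k ^ 2) := by
  have h1 : a ^ 2 + 4 * (h * k) ≤ Real.sqrt (a ^ 2 + 4 * h ^ 2) * Real.sqrt (a ^ 2 + 4 * k ^ 2) := by
    rw [← Real.sqrt_mul (by positivity)]
    apply Real.le_sqrt_of_sq_le
    nlinarith [sq_nonneg (a * (h - k))]
  have s1 := Real.sq_sqrt (show 0 ≤ a ^ 2 + 4 * h ^ 2 by positivity)
  have s2 := Real.sq_sqrt (show 0 ≤ a ^ 2 + 4 * k ^ 2 by positivity)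
  have s3 := Real.sq_sqrt (show 0 ≤ a ^ 2 + (h + k) ^ 2 by positivity)
  refine abs_le_of_sq_le_sq' ?_ (by positivity) |>.2
  nlinarith

/-! ### Coordinates in the plane -/

lemma plane_inner (x y : Plane) : inner ℝ x y = x 0 * y 0 + x 1 * y 1 := by
  simp [PiLp.inner_apply, Fin.sum_univ_two, mul_comm]

lemma plane_norm_sq (x : Plane) : ‖x‖ ^ 2 = x 0 ^ 2 + x 1 ^ 2 := by
  simp [EuclideanSpace.norm_sq_eq, Fin.sum_univ_two]

lemma plane_dist_sq (x y : Plane) : dist x y ^ 2 = (x 0 - y 0) ^ 2 + (x 1 - y 1) ^ 2 := by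
  rw [dist_eq_norm, plane_norm_sq]; simp

lemma continuous_planeCross (v p : Plane) : Continuous fun x : Plane => planeCross v (x - p) := by
  unfold planeCross
  fun_prop

/-! ### Inscribed polygons -/

section polygons

variable {K : Set Plane}

lemma le_perimeter {n : ℕ} (x : Fin (n + 1) → Plane) (hx : IsConvexPolygon x)
    (hK : ∀ i, x i ∈ K) : closedPolygonLength x ≤ perimeter K :=
  le_iSup_of_le n <| le_iSup_of_le x <| le_iSup_of_le hx <| le_iSup_of_le hK le_rfl

lemma two_mul_dist_le_perimeter {x y : Plane} (hx : x ∈ K) (hy : y ∈ K) :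
    ENNReal.ofReal (2 * dist x y) ≤ perimeter K := by
  have h := le_perimeter (K := K) (n := 1) ![x, y]
    (fun i j k hij hjk => by omega)
    (by simp [Fin.forall_fin_two, hx, hy])
  refine le_trans (le_of_eq ?_) h
  simp [closedPolygonLength, Fin.sum_univ_two, edist_dist, dist_comm y x, two_mul,
    ENNReal.ofReal_add]

lemma triangle_le_perimeter_of_pos {x y z : Plane} (hx : x ∈ K) (hy : y ∈ K) (hz : z ∈ K)
    (h : 0 < planeCross (y - x) (z - x)) :
    ENNReal.ofReal (dist x y + dist y z + dist z x) ≤ perimeter K := by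
  have h := le_perimeter (K := K) (n := 2) ![x, y, z]
    (fun i j k hij hjk => by
      fin_cases i <;> fin_cases j <;> fin_cases k <;>
        first | exact absurd hij (by decide) | exact absurd hjk (by decide) | exact h)
    (by simp [Fin.forall_fin_succ, hx, hy, hz])
  refine le_trans (le_of_eq ?_) h
  simp [closedPolygonLength, Fin.sum_univ_three, edist_dist, ENNReal.ofReal_add, add_nonneg]

lemma collinear_of_planeCross_eq_zero {x y z : Plane} (h : planeCross (y - x) (z - x) = 0) :
    Collinear ℝ {x, y, z} := by
  rcases eq_or_ne y x with rfl | hne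
  · simpa using collinear_pair ℝ y z
  · refine (collinear_iff_of_mem (p₀ := x) (by simp)).mpr ⟨y - x, ?_⟩
    have hn : ‖y - x‖ ^ 2 ≠ 0 := by simpa [sub_eq_zero] using hne
    simp only [Set.mem_insert_iff, Set.mem_singleton_iff, forall_eq_or_imp, forall_eq]
    refine ⟨⟨0, by simp⟩, ⟨1, by simp⟩, ⟨inner ℝ (y - x) (z - x) / ‖y - x‖ ^ 2, ?_⟩⟩
    rw [plane_norm_sq] at hn ⊢
    simp only [planeCross, PiLp.sub_apply] at h hn
    ext i
    fin_cases i <;> simp [plane_inner] <;> field_simp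
    · linear_combination -(y 1 - x 1) * h
    · linear_combination (y 0 - x 0) * h

/-- A clockwise triangle is relabelled; a collinear one has twice its longest side as length and is
covered by the two-point polygon. -/
lemma triangle_le_perimeter {x y z : Plane} (hx : x ∈ K) (hy : y ∈ K) (hz : z ∈ K) :
    ENNReal.ofReal (dist x y + dist y z + dist z x) ≤ perimeter K := by
  rcases lt_trichotomy (planeCross (y - x) (z - x)) 0 with h | h | h
  · have h' : 0 < planeCross (z - x) (y - x) := by
      unfold planeCross at h ⊢; linarith
    convert triangle_le_perimeter_of_pos hx hz hy h' using 2
    rw [dist_comm x z, dist_comm z y, dist_comm y x]; ring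
  · rcases (collinear_of_planeCross_eq_zero h).wbtw_or_wbtw_or_wbtw with hw | hw | hw
    · convert two_mul_dist_le_perimeter hz hx using 2
      rw [hw.dist_add_dist, dist_comm z x]; ring
    · convert two_mul_dist_le_perimeter hx hy using 2
      linarith [hw.dist_add_dist, dist_comm x y]
    · convert two_mul_dist_le_perimeter hy hz using 2
      linarith [hw.dist_add_dist, dist_comm y z]
  · exact triangle_le_perimeter_of_pos hx hy hz h

lemma quadrilateral_le_perimeter {p y q x : Plane} (hp : p ∈ K) (hy : y ∈ K) (hq : q ∈ K)
    (hx : x ∈ K) (h₁ : 0 < planeCross (y - p) (q - p)) (h₂ : 0 < planeCross (y - p) (x - p))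
    (h₃ : 0 < planeCross (q - p) (x - p)) (h₄ : 0 < planeCross (q - y) (x - y)) :
    ENNReal.ofReal (dist p y + dist y q + dist q x + dist x p) ≤ perimeter K := by
  have h := le_perimeter (K := K) (n := 3) ![p, y, q, x]
    (fun i j k hij hjk => by
      fin_cases i <;> fin_cases j <;> fin_cases k <;>
        first | exact absurd hij (by decide) | exact absurd hjk (by decide) | simpa)
    (by simp [Fin.forall_fin_succ, hx, hy, hp, hq])
  refine le_trans (le_of_eq ?_) h
  rw [ENNReal.ofReal_add (by positivity) (by positivity),
    ENNReal.ofReal_add (by positivity) (by positivity),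
    ENNReal.ofReal_add (by positivity) (by positivity)]
  simp [closedPolygonLength, Fin.sum_univ_four, edist_dist]

end polygons

/-! ### The bound by the diameter and the width -/

/-- Reflect q in the parallel to pq through x: the broken line p, x, q is at least as long as the
segment from p to the image, whose legs are pq and twice the height of x. -/
lemma sqrt_le_dist_add_dist {p q x : Plane} (h : 0 < dist p q) :
    Real.sqrt (dist p q ^ 2 + 4 * (planeCross (q - p) (x - p) / dist p q) ^ 2) ≤
      dist p x + dist x q := by
  refine Real.sqrt_le_iff.mpr ⟨by positivity, ?_⟩
  have hd := plane_dist_sq p q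
  have hA := plane_dist_sq p x
  have hB := plane_dist_sq x q
  have hD : 0 < dist p q ^ 2 := by positivity
  have key : 4 * (planeCross (q - p) (x - p)) ^ 2 ≤
      ((dist p x + dist x q) ^ 2 - dist p q ^ 2) * dist p q ^ 2 := by
    obtain ⟨H, hH⟩ : ∃ H, H = planeCross (q - p) (x - p) := ⟨_, rfl⟩
    obtain ⟨α, hα⟩ : ∃ α, α = (q 0 - p 0) * (x 0 - p 0) + (q 1 - p 1) * (x 1 - p 1) := ⟨_, rfl⟩
    obtain ⟨β, hβ⟩ : ∃ β, β = (q 0 - p 0) * (x 0 - q 0) + (q 1 - p 1) * (x 1 - q 1) := ⟨_, rfl⟩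
    have hH' : H = (q 0 - p 0) * (x 1 - p 1) - (q 1 - p 1) * (x 0 - p 0) := by
      simp [hH, planeCross]
    have e1 : dist p q ^ 2 * dist p x ^ 2 = α ^ 2 + H ^ 2 := by
      rw [hd, hA, hα, hH']; ring
    have e2 : dist p q ^ 2 * dist x q ^ 2 = β ^ 2 + H ^ 2 := by
      rw [hd, hB, hβ, hH']; ring
    have e3 : dist p q ^ 2 * (dist p x ^ 2 + dist x q ^ 2 - dist p q ^ 2) =
        2 * (α * β + H ^ 2) := by
      rw [hd, hA, hB, hα, hβ, hH']; ring
    -- Cauchy–Schwarz: (α² + H²)(β² + H²) - (H² - αβ)² = H²(α + β)².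
    have h2 : H ^ 2 - α * β ≤ dist p q ^ 2 * (dist p x * dist x q) := by
      refine abs_le_of_sq_le_sq' ?_ (by positivity) |>.2
      have : (dist p q ^ 2 * (dist p x * dist x q)) ^ 2 =
          (dist p q ^ 2 * dist p x ^ 2) * (dist p q ^ 2 * dist x q ^ 2) := by ring
      rw [this, e1, e2]
      nlinarith [sq_nonneg (H * (α + β))]
    rw [← hH]
    linarith
  rw [div_pow, ← mul_div_assoc]
  have := (div_le_iff₀ hD).mpr key
  linarith

/-- If `p`, `q` are two points of `K` at maximal distance, then the points of `K` off the line `pq`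
project to the interior of the segment `pq`. -/
lemma inner_pos_of_dist_le {p q x : Plane} (hq : dist x q ≤ dist p q)
    (hx : planeCross (q - p) (x - p) ≠ 0) :
    0 < (q 0 - p 0) * (x 0 - p 0) + (q 1 - p 1) * (x 1 - p 1) := by
  have h1 : dist x q ^ 2 ≤ dist p q ^ 2 := by gcongr
  rw [plane_dist_sq, plane_dist_sq] at h1
  have h2 : 0 < (x 0 - p 0) ^ 2 + (x 1 - p 1) ^ 2 := by
    by_contra! h
    have h3 : x 0 - p 0 = 0 := by nlinarith [sq_nonneg (x 0 - p 0), sq_nonneg (x 1 - p 1)]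
    have h4 : x 1 - p 1 = 0 := by nlinarith [sq_nonneg (x 0 - p 0), sq_nonneg (x 1 - p 1)]
    exact hx (by simp [planeCross, h3, h4])
  nlinarith

/-- If x and y lie strictly on opposite sides of pq, maximality of pq makes both project inside the
segment, so p, y, q, x is strictly convex. If one of them lies on the line, a triangle suffices. -/
lemma two_broken_lines_le_perimeter {K : Set Plane} {p q x y : Plane} (hp : p ∈ K) (hq : q ∈ K)
    (hx : x ∈ K) (hy : y ∈ K) (hpq : 0 < dist p q)
    (hdiam : ∀ a ∈ K, ∀ b ∈ K, dist a b ≤ dist p q)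
    (hx0 : 0 ≤ planeCross (q - p) (x - p)) (hy0 : planeCross (q - p) (y - p) ≤ 0) :
    ENNReal.ofReal (2 * Real.sqrt (dist p q ^ 2 +
      ((planeCross (q - p) (x - p) - planeCross (q - p) (y - p)) / dist p q) ^ 2)) ≤
      perimeter K := by
  have hsx := sqrt_le_dist_add_dist (x := x) hpq
  have hsy := sqrt_le_dist_add_dist (x := y) hpq
  have hs := two_mul_sqrt_le_sqrt_add_sqrt (dist p q) (planeCross (q - p) (x - p) / dist p q)
    (-(planeCross (q - p) (y - p) / dist p q))
  rw [neg_sq, ← sub_eq_add_neg, ← sub_div] at hs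
  rcases hx0.eq_or_lt with hx1 | hx1
  · rw [← hx1, zero_div, zero_pow two_ne_zero, mul_zero, add_zero, Real.sqrt_sq hpq.le] at hs
    refine le_trans (ENNReal.ofReal_le_ofReal ?_) (triangle_le_perimeter hp hy hq)
    rw [dist_comm q p, ← hx1]
    linarith
  rcases hy0.eq_or_lt with hy1 | hy1
  · rw [hy1, zero_div, zero_pow two_ne_zero, mul_zero, add_zero, Real.sqrt_sq hpq.le] at hs
    refine le_trans (ENNReal.ofReal_le_ofReal ?_) (triangle_le_perimeter hp hx hq)
    rw [dist_comm q p, hy1]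
    linarith
  have hD : 0 < (q 0 - p 0) ^ 2 + (q 1 - p 1) ^ 2 := by
    have : 0 < dist q p ^ 2 := by rw [dist_comm]; positivity
    rwa [plane_dist_sq] at this
  have hxp := inner_pos_of_dist_le (hdiam x hx q hq) hx1.ne'
  have hyp := inner_pos_of_dist_le (hdiam y hy q hq) hy1.ne
  have swap : ∀ z : Plane, planeCross (p - q) (z - q) = - planeCross (q - p) (z - p) := by
    intro z; simp only [planeCross, PiLp.sub_apply]; ring
  have hxq := inner_pos_of_dist_le (p := q) (q := p) (x := x)
    (by rw [dist_comm q p]; exact hdiam x hx p hp) (by rw [swap]; simpa using hx1.ne')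
  have hyq := inner_pos_of_dist_le (p := q) (q := p) (x := y)
    (by rw [dist_comm q p]; exact hdiam y hy p hp) (by rw [swap]; simpa using hy1.ne)
  refine le_trans (ENNReal.ofReal_le_ofReal ?_)
    (quadrilateral_le_perimeter hp hy hq hx ?_ ?_ hx1 ?_)
  · rw [dist_comm q x, dist_comm x p]
    linarith
  · simp only [planeCross, PiLp.sub_apply] at hy1 ⊢
    linarith
  · simp only [planeCross, PiLp.sub_apply] at hx1 hy1 ⊢
    refine pos_of_mul_pos_right (a := (q 0 - p 0) ^ 2 + (q 1 - p 1) ^ 2) ?_ hD.le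
    nlinarith [mul_pos hyp hx1, mul_pos hxp (neg_pos.mpr hy1)]
  · simp only [planeCross, PiLp.sub_apply] at hx1 hy1 ⊢
    refine pos_of_mul_pos_right (a := (q 0 - p 0) ^ 2 + (q 1 - p 1) ^ 2) ?_ hD.le
    nlinarith [mul_pos hyq hx1, mul_pos hxq (neg_pos.mpr hy1)]

lemma nonneg_of_mem_strip_widths {K : Set Plane} (hK : K.Nonempty) :
    ∀ d ∈ {d : ℝ | ∃ u : Plane, ‖u‖ = 1 ∧ ∃ a : ℝ, ∀ x ∈ K,
      a ≤ inner ℝ u x ∧ inner ℝ u x ≤ a + d}, 0 ≤ d := by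
  rintro d ⟨u, -, a, h⟩
  obtain ⟨x, hx⟩ := hK
  linarith [h x hx]

lemma minWidth_nonneg {K : Set Plane} (hK : K.Nonempty) : 0 ≤ minWidth K :=
  Real.sInf_nonneg (nonneg_of_mem_strip_widths hK)

lemma minWidth_le {K : Set Plane} (hK : K.Nonempty) {u : Plane} (hu : ‖u‖ = 1) {a d : ℝ}
    (h : ∀ x ∈ K, a ≤ inner ℝ u x ∧ inner ℝ u x ≤ a + d) : minWidth K ≤ d :=
  csInf_le ⟨0, nonneg_of_mem_strip_widths hK⟩ ⟨u, hu, a, h⟩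

lemma minWidth_le_of_planeCross {K : Set Plane} (hK : K.Nonempty) {p q : Plane}
    (hpq : 0 < dist p q) {a b : ℝ} (h : ∀ z ∈ K, planeCross (q - p) (z - p) ∈ Set.Icc a b) :
    minWidth K ≤ (b - a) / dist p q := by
  -- The unit normal is q - p rotated by a right angle and normalised; c accounts for the line pq
  -- not passing through the origin.
  set c := (p 0 * q 1 - p 1 * q 0) with hc
  have hin : ∀ z : Plane, inner ℝ ((dist p q)⁻¹ • !₂[-(q 1 - p 1), q 0 - p 0] : Plane) z =
      (planeCross (q - p) (z - p) - c) / dist p q := by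
    intro z
    rw [plane_inner]
    simp [planeCross, hc]
    field_simp
    ring
  refine minWidth_le hK (u := (dist p q)⁻¹ • !₂[-(q 1 - p 1), q 0 - p 0]) ?_
    (a := (a - c) / dist p q) ?_
  · rw [← sq_eq_sq₀ (norm_nonneg _) zero_le_one, norm_smul, mul_pow, plane_norm_sq, norm_inv,
      Real.norm_of_nonneg hpq.le, inv_pow, plane_dist_sq]
    have : 0 < dist p q ^ 2 := by positivity
    rw [plane_dist_sq] at this
    simp
    field_simp
    ring
  · intro z hz
    obtain ⟨h1, h2⟩ := h z hz
    rw [hin, ← add_div]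
    constructor <;> gcongr
    linarith

/-- A body that contains two points at distance `d` and has minimum width `w` has perimeter at
least `2 √(d² + w²)`. -/
lemma two_mul_sqrt_le_perimeter {K : Set Plane} (hK : IsCompact K) {a b : Plane} (ha : a ∈ K)
    (hb : b ∈ K) (hab : a ≠ b) :
    ENNReal.ofReal (2 * Real.sqrt (dist a b ^ 2 + minWidth K ^ 2)) ≤ perimeter K := by
  have hne : K.Nonempty := ⟨a, ha⟩
  obtain ⟨z, hz, hmax⟩ := (hK.prod hK).exists_isMaxOn (hne.prod hne)
    (continuous_dist (α := Plane)).continuousOn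
  obtain ⟨p, q⟩ := z
  have hp : p ∈ K := hz.1
  have hq : q ∈ K := hz.2
  have hdiam : ∀ x ∈ K, ∀ y ∈ K, dist x y ≤ dist p q := fun x hx y hy =>
    isMaxOn_iff.mp hmax (x, y) (Set.mk_mem_prod hx hy)
  have hpq : 0 < dist p q := (dist_pos.mpr hab).trans_le (hdiam a ha b hb)
  -- The strip parallel to the diametral pair pq and touching `K` at x and y has width at least
  -- `minWidth K`.
  obtain ⟨x, hx, hxmax⟩ := hK.exists_isMaxOn hne (continuous_planeCross (q - p) p).continuousOn
  obtain ⟨y, hy, hymin⟩ := hK.exists_isMinOn hne (continuous_planeCross (q - p) p).continuousOn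
  have h0 : planeCross (q - p) (p - p) = 0 := by simp [planeCross]
  have hx0 : planeCross (q - p) (p - p) ≤ planeCross (q - p) (x - p) :=
    isMaxOn_iff.mp hxmax p hp
  have hy0 : planeCross (q - p) (y - p) ≤ planeCross (q - p) (p - p) :=
    isMinOn_iff.mp hymin p hp
  rw [h0] at hx0 hy0
  have hIcc : ∀ z ∈ K, planeCross (q - p) (z - p) ∈
      Set.Icc (planeCross (q - p) (y - p)) (planeCross (q - p) (x - p)) :=
    fun z hz => Set.mem_Icc.mpr ⟨isMinOn_iff.mp hymin z hz, isMaxOn_iff.mp hxmax z hz⟩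
  have hw := minWidth_le_of_planeCross hne hpq hIcc
  have hw0 := minWidth_nonneg hne
  have hd := hdiam a ha b hb
  refine le_trans (ENNReal.ofReal_le_ofReal ?_)
    (two_broken_lines_le_perimeter hp hq hx hy hpq hdiam hx0 hy0)
  refine mul_le_mul_of_nonneg_left (Real.sqrt_le_sqrt (add_le_add ?_ ?_)) zero_le_two
  · exact pow_le_pow_left₀ dist_nonneg hd 2
  · exact pow_le_pow_left₀ hw0 hw 2

/-! ### The circumscribed disc -/

lemma exists_minimal_closedBall {E : Type*} [MetricSpace E] [ProperSpace E] {K : Set E} (hK : IsCompact K) (hne : K.Nonempty) :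
    ∃ (c : E) (R : ℝ), K ⊆ Metric.closedBall c R ∧
      ∀ c' ρ, K ⊆ Metric.closedBall c' ρ → R ≤ ρ := by
  obtain ⟨x₀, hx₀⟩ := hne
  obtain ⟨ρ₀, hρ₀⟩ := hK.isBounded.subset_closedBall x₀
  have hnn : ∀ c ρ, K ⊆ Metric.closedBall c ρ → dist x₀ c ≤ ρ := fun c ρ h => h hx₀
  -- A ball of radius at most ρ₀ that contains x₀ has its centre within ρ₀ of x₀, so the competitors
  -- form a compact set.
  set T : Set (E × ℝ) := (Metric.closedBall x₀ ρ₀ ×ˢ Set.Icc 0 ρ₀) ∩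
    {z | K ⊆ Metric.closedBall z.1 z.2} with hT
  have hTc : IsCompact T := by
    refine ((isCompact_closedBall x₀ ρ₀).prod isCompact_Icc).inter_right ?_
    have : {z : E × ℝ | K ⊆ Metric.closedBall z.1 z.2} = ⋂ x ∈ K, {z | dist x z.1 ≤ z.2} := by
      ext z; simp [Set.subset_def]
    rw [this]
    exact isClosed_biInter fun x _ => isClosed_le (by fun_prop) (by fun_prop)
  have h0 : 0 ≤ ρ₀ := by simpa using hnn x₀ ρ₀ hρ₀
  obtain ⟨⟨c, R⟩, ⟨hmem, hc⟩, hmin⟩ := hTc.exists_isMinOn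
    ⟨(x₀, ρ₀), ⟨⟨by simpa using h0, h0, le_rfl⟩, hρ₀⟩⟩ continuous_snd.continuousOn
  refine ⟨c, R, hc, fun c' ρ h => ?_⟩
  rcases le_total ρ ρ₀ with hle | hle
  · have h1 := hnn c' ρ h
    refine hmin (a := (c', ρ)) ⟨⟨?_, dist_nonneg.trans h1, hle⟩, h⟩
    rw [Metric.mem_closedBall, dist_comm]
    exact h1.trans hle
  · exact hmem.2.2.trans hle

section circumdisc

variable {E : Type*} [NormedAddCommGroup E] [InnerProductSpace ℝ E]

/-- In every closed half plane bounded by a line through the centre of the smallest disc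
containing `K` there is a point of `K` on the boundary circle. -/
lemma exists_mem_sphere_inner_le {K : Set E} (hK : IsCompact K) (hne : K.Nonempty) {c : E} {R : ℝ}
    (hc : K ⊆ Metric.closedBall c R) (hmin : ∀ c' ρ, K ⊆ Metric.closedBall c' ρ → R ≤ ρ) (v : E) :
    ∃ x ∈ K ∩ Metric.sphere c R, inner ℝ v (x - c) ≤ 0 := by
  -- A nonpositive value of this maximum encodes both requirements at once. By compactness values
  -- below every δ > 0 suffice; they come from the point of `K` farthest from the displaced centre c
  -- + εv, at distance at least R from it.
  obtain ⟨x, hx, hxmin⟩ := hK.exists_isMinOn hne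
    (f := fun x => max (inner ℝ v (x - c)) (R - dist x c)) (by fun_prop)
  have hle : max (inner ℝ v (x - c)) (R - dist x c) ≤ 0 := by
    refine le_of_forall_pos_le_add fun δ hδ => ?_
    obtain ⟨ε, hε, hε1, hε2⟩ : ∃ ε > 0, ε * ‖v‖ ^ 2 ≤ δ ∧ ε * ‖v‖ ≤ δ := by
      refine ⟨δ / (1 + ‖v‖ ^ 2 + ‖v‖), by positivity, ?_, ?_⟩ <;>
      · rw [div_mul_eq_mul_div, div_le_iff₀ (by positivity)]
        gcongr
        nlinarith [norm_nonneg v]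
    obtain ⟨y, hy, hymax⟩ := hK.exists_isMaxOn hne
      (f := fun y => dist y (c + ε • v)) (by fun_prop)
    have hR : R ≤ dist y (c + ε • v) := hmin (c + ε • v) _ fun z hz => hymax hz
    refine (hxmin hy).trans ?_
    have hyc : dist y c ≤ R := hc hy
    simp only [zero_add]
    refine max_le ?_ ?_
    · rw [dist_eq_norm] at hR hyc
      have h1 : ‖y - c‖ ^ 2 ≤ ‖y - (c + ε • v)‖ ^ 2 := by
        gcongr; exact hyc.trans hR
      have h2 : ‖y - (c + ε • v)‖ ^ 2 =
          ‖y - c‖ ^ 2 - 2 * (ε * inner ℝ v (y - c)) + ε ^ 2 * ‖v‖ ^ 2 := by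
        rw [← sub_sub, norm_sub_sq_real, inner_smul_right, real_inner_comm, norm_smul, mul_pow,
          Real.norm_of_nonneg hε.le]
      have h3 : ε * inner ℝ v (y - c) ≤ ε * δ := by
        nlinarith [mul_le_mul_of_nonneg_left hε1 hε.le]
      exact le_of_mul_le_mul_left h3 hε
    · have : dist y (c + ε • v) ≤ dist y c + ε * ‖v‖ := by
        refine (dist_triangle y c _).trans (le_of_eq ?_)
        simp [norm_smul, abs_of_pos hε]
      linarith
  refine ⟨x, ⟨hx, le_antisymm (hc hx) ?_⟩, (le_max_left _ _).trans hle⟩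
  linarith [(le_max_right (inner ℝ v (x - c)) (R - dist x c)).trans hle]

lemma exists_fin_three_of_mem_convexHull [FiniteDimensional ℝ E] (hE : Module.finrank ℝ E = 2)
    {S : Set E} {x : E} (hx : x ∈ convexHull ℝ S) :
    ∃ l ∈ stdSimplex ℝ (Fin 3), ∃ z ∈ Set.univ.pi fun _ : Fin 3 => S, ∑ i, l i • z i = x := by
  have hS : S.Nonempty := convexHull_nonempty_iff.mp ⟨x, hx⟩
  obtain ⟨z₀, hz₀⟩ := hS
  obtain ⟨ι, _, z, w, hz, hind, hw, hsum, hx⟩ := eq_pos_convex_span_of_mem_convexHull hx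
  have hcard : Fintype.card ι ≤ Fintype.card (Fin 3) := by
    have := hind.card_le_finrank_succ
    have h2 := Submodule.finrank_le (vectorSpan ℝ (Set.range z))
    simp only [Fintype.card_fin]
    omega
  obtain ⟨e⟩ := Function.Embedding.nonempty_of_card_le hcard
  have he := e.injective
  -- Carathéodory may give fewer than three points; the remaining slots get weight 0 and the dummy
  -- point z₀.
  refine ⟨Function.extend e w 0, ⟨fun i => ?_, ?_⟩, Function.extend e z fun _ => z₀,
    fun i _ => ?_, ?_⟩
  · by_cases hi : ∃ a, e a = i
    · obtain ⟨a, rfl⟩ := hi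
      rw [he.extend_apply]; exact (hw a).le
    · rw [Function.extend_apply' _ _ _ hi]; rfl
  · rw [← hsum]
    refine (Fintype.sum_of_injective e he _ _ (fun i hi => ?_) fun a => ?_).symm
    · rw [Function.extend_apply' _ _ _ hi]; rfl
    · rw [he.extend_apply]
  · by_cases hi : ∃ a, e a = i
    · obtain ⟨a, rfl⟩ := hi
      rw [he.extend_apply]; exact hz ⟨a, rfl⟩
    · rw [Function.extend_apply' _ _ _ hi]; exact hz₀
  · rw [← hx]
    refine (Fintype.sum_of_injective e he _ _ (fun i hi => ?_) fun a => ?_).symm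
    · rw [Function.extend_apply' _ _ _ hi]; simp
    · rw [he.extend_apply, he.extend_apply]

/-- A functional separating c from the hull of the contact points would contradict
`exists_mem_sphere_inner_le`. Three-point combinations form a compact set, so passing to the closure
of the hull loses nothing. -/
lemma exists_fin_three_center [FiniteDimensional ℝ E] (hE : Module.finrank ℝ E = 2)
    {K : Set E} (hK : IsCompact K) (hne : K.Nonempty) {c : E} {R : ℝ}
    (hc : K ⊆ Metric.closedBall c R) (hmin : ∀ c' ρ, K ⊆ Metric.closedBall c' ρ → R ≤ ρ) :
    ∃ l ∈ stdSimplex ℝ (Fin 3), ∃ z ∈ Set.univ.pi fun _ : Fin 3 => K ∩ Metric.sphere c R,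
      ∑ i, l i • z i = c := by
  set S := K ∩ Metric.sphere c R
  have hS : IsCompact S := hK.inter_right Metric.isClosed_sphere
  set T : Set E := (fun p : (Fin 3 → ℝ) × (Fin 3 → E) => ∑ i, p.1 i • p.2 i) ''
    (stdSimplex ℝ (Fin 3) ×ˢ Set.univ.pi fun _ : Fin 3 => S) with hT
  have hTc : IsCompact T :=
    ((isCompact_stdSimplex ℝ (Fin 3)).prod (isCompact_univ_pi fun _ => hS)).image (by fun_prop)
  have hsub : closure (convexHull ℝ S) ⊆ T := by
    refine closure_minimal (fun x hx => ?_) hTc.isClosed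
    obtain ⟨l, hl, z, hz, h⟩ := exists_fin_three_of_mem_convexHull hE hx
    exact ⟨(l, z), ⟨hl, hz⟩, h⟩
  suffices h : c ∈ closure (convexHull ℝ S) by
    obtain ⟨⟨l, z⟩, ⟨hl, hz⟩, h⟩ := hsub h
    exact ⟨l, hl, z, hz, h⟩
  by_contra hcl
  obtain ⟨f, u, hfc, hf⟩ :=
    geometric_hahn_banach_point_closed (convex_convexHull ℝ S).closure isClosed_closure hcl
  obtain ⟨x, hx, hle⟩ :=
    exists_mem_sphere_inner_le hK hne hc hmin ((InnerProductSpace.toDual ℝ E).symm f)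
  rw [InnerProductSpace.toDual_symm_apply, map_sub] at hle
  linarith [hf x (subset_closure (subset_convexHull ℝ S hx))]

/-- Some central angle is at least 120°. Otherwise, pairing the relation with each vector makes
every weight at most 1/3, hence equal to 1/3, and pairing once more is contradictory. -/
lemma exists_inner_le_of_sum_eq_zero {X : Fin 3 → E} {l : Fin 3 → ℝ} {R : ℝ} (hR : 0 < R)
    (hX : ∀ i, ‖X i‖ = R) (hl : l ∈ stdSimplex ℝ (Fin 3)) (h : ∑ i, l i • X i = 0) :
    ∃ i j k, 0 ≤ l i ∧ 0 ≤ l j ∧ 0 ≤ l k ∧ l i + l j + l k = 1 ∧ l i • X i + l j • X j + l k • X k = 0 ∧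
      inner ℝ (X i) (X j) ≤ - (R ^ 2 / 2) := by
  obtain ⟨hl0, hl1⟩ := hl
  rw [Fin.sum_univ_three] at h hl1
  by_contra! hcon
  have h01 := hcon 0 1 2 (hl0 _) (hl0 _) (hl0 _) hl1 h
  have h02 := hcon 0 2 1 (hl0 _) (hl0 _) (hl0 _) (by linarith) (by rw [← h]; abel)
  have h12 := hcon 1 2 0 (hl0 _) (hl0 _) (hl0 _) (by linarith) (by rw [← h]; abel)
  have hs : ∀ i, inner ℝ (X i) (X i) = R ^ 2 := fun i => by rw [real_inner_self_eq_norm_sq, hX]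
  have e : ∀ i, l 0 * inner ℝ (X i) (X 0) + l 1 * inner ℝ (X i) (X 1) +
      l 2 * inner ℝ (X i) (X 2) = 0 := by
    intro i
    have := congrArg (inner ℝ (X i)) h
    simpa [inner_add_right, inner_smul_right] using this
  have e0 := e 0
  have e1 := e 1
  have e2 := e 2
  rw [hs] at e0 e1 e2
  rw [real_inner_comm (X 0) (X 1)] at e1
  rw [real_inner_comm (X 0) (X 2), real_inner_comm (X 1) (X 2)] at e2
  have hR2 : 0 < R ^ 2 := by positivity
  have p0 := hl0 0
  have p1 := hl0 1
  have p2 := hl0 2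
  have a0 : l 0 ≤ 1 / 3 := by
    nlinarith [mul_nonneg p1 (sub_pos.mpr h01).le, mul_nonneg p2 (sub_pos.mpr h02).le]
  have a1 : l 1 ≤ 1 / 3 := by
    nlinarith [mul_nonneg p0 (sub_pos.mpr h01).le, mul_nonneg p2 (sub_pos.mpr h12).le]
  have a2 : l 2 ≤ 1 / 3 := by
    nlinarith [mul_nonneg p0 (sub_pos.mpr h02).le, mul_nonneg p1 (sub_pos.mpr h12).le]
  have b0 : l 0 = 1 / 3 := by linarith
  have b1 : l 1 = 1 / 3 := by linarith
  have b2 : l 2 = 1 / 3 := by linarith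
  rw [b0, b1, b2] at e0
  linarith

/-- For a triangle with vertices `x, y, z` inscribed in the circle of radius `R` about the origin
and containing the origin, `m = ‖x + y‖ / 2` is the distance of the origin to the side `xy`. -/
lemma two_mul_add_le_dist_add_dist {x y z : E} {R a b d : ℝ} (hR : 0 < R) (hx : ‖x‖ = R)
    (hy : ‖y‖ = R) (hz : ‖z‖ = R) (ha : 0 ≤ a) (hb : 0 ≤ b) (hd : 0 < d)
    (h : a • x + b • y + d • z = 0) :
    2 * (R + ‖x + y‖ / 2) ≤ dist y z + dist z x := by
  have hm : ‖x + y‖ ^ 2 = 2 * R ^ 2 + 2 * inner ℝ x y := by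
    rw [norm_add_sq_real, hx, hy]; ring
  have hd1 : d ≤ a + b := by
    have h1 : d • z = -(a • x + b • y) := by rw [eq_neg_iff_add_eq_zero, ← h]; abel
    have h2 : ‖d • z‖ ≤ ‖a • x‖ + ‖b • y‖ := by
      rw [h1, norm_neg]; exact norm_add_le _ _
    rw [norm_smul, norm_smul, norm_smul, hx, hy, hz, Real.norm_of_nonneg ha,
      Real.norm_of_nonneg hb, Real.norm_of_nonneg hd.le, ← add_mul] at h2
    exact le_of_mul_le_mul_right h2 hR
  have hs : ∀ w : E, ‖w‖ = R → inner ℝ w w = R ^ 2 := fun w hw => by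
    rw [real_inner_self_eq_norm_sq, hw]
  have e : ∀ w : E, a * inner ℝ w x + b * inner ℝ w y + d * inner ℝ w z = 0 := by
    intro w
    have := congrArg (inner ℝ w) h
    simpa [inner_add_right, inner_smul_right] using this
  have ex := e x
  have ey := e y
  have ez := e z
  rw [hs x hx] at ex
  rw [hs y hy, real_inner_comm x y] at ey
  rw [hs z hz, real_inner_comm x z, real_inner_comm y z] at ez
  have hyz : dist y z ^ 2 = 2 * (R ^ 2 - inner ℝ y z) := by
    rw [dist_eq_norm, norm_sub_sq_real, hy, hz]; ring
  have hzx : dist z x ^ 2 = 2 * (R ^ 2 - inner ℝ x z) := by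
    rw [dist_comm, dist_eq_norm, norm_sub_sq_real, hx, hz]; ring
  have hα : 0 ≤ R ^ 2 + inner ℝ x y := by nlinarith [sq_nonneg ‖x + y‖]
  have hα' : inner ℝ x y ≤ R ^ 2 := by
    have := real_inner_le_norm x y
    rw [hx, hy] at this; nlinarith
  generalize inner ℝ x y = α at *
  generalize inner ℝ y z = γ at *
  generalize inner ℝ x z = β at *
  have hβ : d * β = -(a * R ^ 2 + b * α) := by linarith
  have hγ : d * γ = -(a * α + b * R ^ 2) := by linarith
  have hdd : d ^ 2 * R ^ 2 = (a ^ 2 + b ^ 2) * R ^ 2 + 2 * a * b * α := by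
    have : d * (a * β + b * γ + d * R ^ 2) = 0 := by rw [ez, mul_zero]
    linear_combination this - a * hβ - b * hγ
  -- With m = ‖x + y‖ / 2 this says yz² + zx² ≥ 4R² + 4m², and `hprod` says yz · zx ≥ 4Rm; together
  -- they give (yz + zx)² ≥ 4(R + m)².
  have hsum : R ^ 2 + α ≤ - (β + γ) := by
    have : d * (R ^ 2 + α) ≤ d * (-(β + γ)) := by
      have : d * (-(β + γ)) = (a + b) * (R ^ 2 + α) := by linear_combination - hβ - hγ
      rw [this]; gcongr
    exact le_of_mul_le_mul_left this hd
  have hprod : 2 * R ^ 2 * (R ^ 2 + α) ≤ (R ^ 2 - γ) * (R ^ 2 - β) := by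
    have h1 : d ^ 2 * ((R ^ 2 - γ) * (R ^ 2 - β)) =
        (R ^ 2 + α) * (d ^ 2 * R ^ 2 + d * (a + b) * R ^ 2 + a * b * (R ^ 2 - α)) := by
      have : d ^ 2 * ((R ^ 2 - γ) * (R ^ 2 - β)) = (d * R ^ 2 - d * γ) * (d * R ^ 2 - d * β) := by
        ring
      rw [this, hβ, hγ]
      linear_combination (-α) * hdd
    have h2 : d ^ 2 * (2 * R ^ 2 * (R ^ 2 + α)) ≤ d ^ 2 * ((R ^ 2 - γ) * (R ^ 2 - β)) := by
      rw [h1]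
      have h3 : 2 * d ^ 2 * R ^ 2 ≤
          d ^ 2 * R ^ 2 + d * (a + b) * R ^ 2 + a * b * (R ^ 2 - α) := by
        have h4 : d * d * R ^ 2 ≤ d * (a + b) * R ^ 2 := by gcongr
        nlinarith [mul_nonneg (mul_nonneg ha hb) (sub_nonneg.mpr hα')]
      nlinarith [mul_le_mul_of_nonneg_left h3 hα]
    exact le_of_mul_le_mul_left h2 (by positivity)
  have hmul : 2 * R * ‖x + y‖ ≤ 2 * (dist y z * dist z x) := by
    refine abs_le_of_sq_le_sq' ?_ (by positivity) |>.2
    have e1 : (2 * (dist y z * dist z x)) ^ 2 = 4 * (dist y z ^ 2 * dist z x ^ 2) := by ring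
    rw [e1, hyz, hzx, mul_pow, hm]
    nlinarith
  refine abs_le_of_sq_le_sq' ?_ (by positivity) |>.2
  nlinarith

lemma exists_inscribed_triangle [FiniteDimensional ℝ E] (hE : Module.finrank ℝ E = 2)
    {K : Set E} (hK : IsCompact K) (hne : K.Nonempty) {c : E} {R : ℝ} (hR : 0 < R)
    (hc : K ⊆ Metric.closedBall c R) (hmin : ∀ c' ρ, K ⊆ Metric.closedBall c' ρ → R ≤ ρ) :
    ∃ x ∈ K, ∃ y ∈ K, ∃ z ∈ K, ∃ m, 0 ≤ m ∧ m ≤ R / 2 ∧ dist x y ^ 2 = 4 * (R ^ 2 - m ^ 2) ∧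
      2 * (R + m) ≤ dist y z + dist z x := by
  obtain ⟨l, hl, z, hz, hsum⟩ := exists_fin_three_center hE hK hne hc hmin
  have hz' : ∀ i, z i ∈ K ∩ Metric.sphere c R := fun i => hz i (Set.mem_univ i)
  have hn : ∀ i, ‖z i - c‖ = R := fun i => by
    have := (hz' i).2
    rwa [Metric.mem_sphere, dist_eq_norm] at this
  have h0 : ∑ i, l i • (z i - c) = 0 := by
    simp only [smul_sub, Finset.sum_sub_distrib, hsum, ← Finset.sum_smul, hl.2, one_smul, sub_self]
  obtain ⟨i, j, k, hi, hj, hk, hs, h, hin⟩ := exists_inner_le_of_sum_eq_zero hR hn hl h0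
  have hm : ‖(z i - c) + (z j - c)‖ ^ 2 = 2 * R ^ 2 + 2 * inner ℝ (z i - c) (z j - c) := by
    rw [norm_add_sq_real, hn, hn]; ring
  have hd : dist (z i) (z j) ^ 2 = 2 * R ^ 2 - 2 * inner ℝ (z i - c) (z j - c) := by
    rw [dist_eq_norm, ← sub_sub_sub_cancel_right _ _ c, norm_sub_sq_real, hn, hn]; ring
  have hm2 : ‖(z i - c) + (z j - c)‖ / 2 ≤ R / 2 := by
    have : ‖(z i - c) + (z j - c)‖ ^ 2 ≤ R ^ 2 := by rw [hm]; linarith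
    linarith [abs_le_of_sq_le_sq' this hR.le]
  have hdm : dist (z i) (z j) ^ 2 = 4 * (R ^ 2 - (‖(z i - c) + (z j - c)‖ / 2) ^ 2) := by
    rw [hd, div_pow, hm]; ring
  -- With third weight 0 the first two points are antipodal; then m = 0 and the triangle degenerates
  -- to a doubled diameter, with the first point repeated.
  rcases hk.eq_or_lt with hk | hk
  · have h1 : l i • (z i - c) = -(l j • (z j - c)) := by
      rw [← hk, zero_smul, add_zero] at h
      exact eq_neg_of_add_eq_zero_left h
    have h2 := congrArg norm h1
    rw [norm_neg, norm_smul, norm_smul, hn, hn, Real.norm_of_nonneg hi, Real.norm_of_nonneg hj] at h2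
    have h3 : l i = l j := mul_right_cancel₀ hR.ne' h2
    have h4 : l i = 1 / 2 := by linarith
    have h5 : ‖(z i - c) + (z j - c)‖ = 0 := by
      rw [← h3, ← smul_neg] at h1
      have h6 := smul_right_injective E (by rw [h4]; norm_num : l i ≠ 0) h1
      rw [h6]; simp
    rw [h5] at hdm
    refine ⟨z i, (hz' i).1, z j, (hz' j).1, z i, (hz' i).1, 0, le_rfl, by linarith,
      by rw [hdm]; ring, ?_⟩
    rw [dist_self, add_zero, add_zero, dist_comm]
    refine abs_le_of_sq_le_sq' ?_ (dist_nonneg (x := z i) (y := z j)) |>.2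
    rw [hdm]; apply le_of_eq; ring
  · refine ⟨z i, (hz' i).1, z j, (hz' j).1, z k, (hz' k).1, _, by positivity, hm2, hdm, ?_⟩
    have := two_mul_add_le_dist_add_dist hR (hn i) (hn j) (hn k) hi hj hk h
    simpa using this

end circumdisc

/-! ### The main inequality -/

lemma circumradius_eq {K : Set Plane} {c : Plane} {R : ℝ} (hc : K ⊆ Metric.closedBall c R)
    (hmin : ∀ c' ρ, K ⊆ Metric.closedBall c' ρ → R ≤ ρ) : circumradius K = R :=
  IsLeast.csInf_eq ⟨⟨c, hc⟩, fun _ ⟨c', h⟩ => hmin c' _ h⟩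

lemma minWidth_le_two_mul {K : Set Plane} (hK : K.Nonempty) {c : Plane} {R : ℝ}
    (hc : K ⊆ Metric.closedBall c R) : minWidth K ≤ 2 * R := by
  have hu : ‖(EuclideanSpace.single 0 1 : Plane)‖ = 1 := by simp
  refine minWidth_le hK hu (a := inner ℝ (EuclideanSpace.single 0 1 : Plane) c - R) fun x hx => ?_
  have h1 := abs_real_inner_le_norm (EuclideanSpace.single 0 1 : Plane) (x - c)
  have h2 : ‖x - c‖ ≤ R := by rw [← dist_eq_norm]; exact hc hx
  rw [hu, one_mul, inner_sub_right] at h1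
  have h3 := abs_le.mp (h1.trans h2)
  constructor <;> linarith

theorem perimeterLowerBound_le_perimeter {K : Set Plane} (hK : IsCompact K) (hK2 : K.Nontrivial) :
    ENNReal.ofReal (perimeterLowerBound (circumradius K) (minWidth K)) ≤ perimeter K := by
  have hne := hK2.nonempty
  obtain ⟨c, R, hc, hmin⟩ := exists_minimal_closedBall hK hne
  have hR : 0 < R := by
    by_contra! h
    exact Set.not_subsingleton_iff.mpr hK2 ((Metric.subsingleton_closedBall c h).anti hc)
  rw [circumradius_eq hc hmin]
  obtain ⟨x, hx, y, hy, z, hz, m, hm0, hm, hxy, hsum⟩ :=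
    exists_inscribed_triangle (by simp) hK hne hR hc hmin
  have hpos : 0 < dist x y := by
    have : 0 < dist x y ^ 2 := by rw [hxy]; nlinarith
    exact dist_nonneg.lt_of_ne fun h => by simp [← h] at this
  rcases perimeterLowerBound_le_or hR (minWidth_nonneg hne) (minWidth_le_two_mul hne hc) hm0 hm
    with h | h
  · refine le_trans (ENNReal.ofReal_le_ofReal (h.trans ?_)) (triangle_le_perimeter hx hy hz)
    have : 2 * Real.sqrt (R ^ 2 - m ^ 2) = dist x y := by
      rw [← Real.sqrt_sq (dist_nonneg (x := x) (y := y)), hxy, Real.sqrt_mul (by norm_num),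
        show (4 : ℝ) = 2 ^ 2 by norm_num, Real.sqrt_sq zero_le_two]
    linarith
  · refine le_trans (ENNReal.ofReal_le_ofReal (h.trans ?_))
      (two_mul_sqrt_le_perimeter hK hx hy (dist_pos.mp hpos))
    rw [hxy]

/-! ### Segments -/

lemma dist_le_of_mem_segment {a b x y : Plane} (hx : x ∈ segment ℝ a b) (hy : y ∈ segment ℝ a b) :
    dist x y ≤ dist a b := by
  rw [segment_eq_image_lineMap] at hx hy
  obtain ⟨s, hs, rfl⟩ := hx
  obtain ⟨t, ht, rfl⟩ := hy
  rw [dist_lineMap_lineMap]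
  refine mul_le_of_le_one_left dist_nonneg ?_
  rw [Real.dist_eq, abs_le]
  constructor <;> linarith [hs.1, hs.2, ht.1, ht.2]

lemma planeCross_eq_zero_of_mem_segment {a b x y z : Plane} (hx : x ∈ segment ℝ a b)
    (hy : y ∈ segment ℝ a b) (hz : z ∈ segment ℝ a b) : planeCross (y - x) (z - x) = 0 := by
  rw [segment_eq_image'] at hx hy hz
  obtain ⟨r, -, rfl⟩ := hx
  obtain ⟨s, -, rfl⟩ := hy
  obtain ⟨t, -, rfl⟩ := hz
  simp [planeCross]
  ring

lemma circumradius_segment (a b : Plane) : circumradius (segment ℝ a b) = dist a b / 2 := by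
  refine circumradius_eq (c := midpoint ℝ a b) ?_ fun c ρ h => ?_
  · refine (convex_closedBall _ _).segment_subset ?_ ?_ <;> rw [Metric.mem_closedBall]
    · rw [dist_left_midpoint]; norm_num; linarith
    · rw [dist_right_midpoint]; norm_num; linarith
  · have ha : dist a c ≤ ρ := h (left_mem_segment ℝ a b)
    have hb : dist b c ≤ ρ := h (right_mem_segment ℝ a b)
    linarith [dist_triangle_right a b c]

lemma minWidth_segment {a b : Plane} (hab : a ≠ b) : minWidth (segment ℝ a b) = 0 := by
  have hne : (segment ℝ a b).Nonempty := ⟨a, left_mem_segment ℝ a b⟩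
  refine le_antisymm ?_ (minWidth_nonneg hne)
  have := minWidth_le_of_planeCross hne (dist_pos.mpr hab) (a := 0) (b := 0) fun z hz => by
    rw [planeCross_eq_zero_of_mem_segment (left_mem_segment ℝ a b) (right_mem_segment ℝ a b) hz]
    simp
  simpa using this

lemma perimeterLowerBound_zero_right {R : ℝ} (hR : 0 ≤ R) : perimeterLowerBound R 0 = 4 * R := by
  simp [perimeterLowerBound, Real.sqrt_sq hR]

lemma perimeter_segment_le (a b : Plane) :
    perimeter (segment ℝ a b) ≤ ENNReal.ofReal (2 * dist a b) := by
  refine iSup_le fun n => iSup_le fun x => iSup_le fun hx => iSup_le fun hK => ?_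
  -- There are n + 1 vertices: one gives length 0, two give a doubled chord, and three or more
  -- cannot be strictly convex on a line.
  match n with
  | 0 => simp [closedPolygonLength]
  | 1 =>
    have h := dist_le_of_mem_segment (hK 0) (hK 1)
    have e : closedPolygonLength x = ENNReal.ofReal (2 * dist (x 0) (x 1)) := by
      simp [closedPolygonLength, Fin.sum_univ_two, edist_dist, dist_comm (x 1) (x 0), two_mul,
        ENNReal.ofReal_add]
    rw [e]
    exact ENNReal.ofReal_le_ofReal (by linarith)
  | n + 2 =>
    have h := hx ⟨0, by omega⟩ ⟨1, by omega⟩ ⟨2, by omega⟩ (by simp) (by simp [Fin.lt_def])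
    rw [planeCross_eq_zero_of_mem_segment (hK _) (hK _) (hK _)] at h
    exact absurd h (lt_irrefl 0)

theorem mainTheorem10 :
    (∀ K : ConvexBody Plane, (K : Set Plane).Nontrivial →
      ENNReal.ofReal (perimeterLowerBound (circumradius K) (minWidth K)) ≤ perimeter K) ∧
    (∀ a b : Plane, a ≠ b →
      perimeter (segment ℝ a b) =
        ENNReal.ofReal
          (perimeterLowerBound (circumradius (segment ℝ a b)) (minWidth (segment ℝ a b)))) := by
  refine ⟨fun K hK => perimeterLowerBound_le_perimeter K.isCompact hK, fun a b hab => ?_⟩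
  rw [circumradius_segment, minWidth_segment hab, perimeterLowerBound_zero_right (by positivity),
    show 4 * (dist a b / 2) = 2 * dist a b by ring]
  exact le_antisymm (perimeter_segment_le a b)
    (two_mul_dist_le_perimeter (left_mem_segment ℝ a b) (right_mem_segment ℝ a b))
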